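/- Let $A$ be a unital C*-algebra and let $l_2(A)$ be the standard Hilbert $A$-module of all sequences $a=(a_i)_{i\in\mathbb N}$ in $A$ for which $\sum_i a_ia_i^*$ converges in norm, with $\langle a,b\rangle=\sum_i a_ib_i^*$. Let $\mathbb J$ be a finite or countable index set. A family $\{x_j\}_{j\in\mathbb J}$ in a Hilbert $A$-module $\mathcal H$ is a standard normalized tight frame of $\mathcal H$ if $\sum_j\langle h,x_j\rangle\langle x_j,h\rangle=\langle h,h\rangle$, with convergence in norm, for every $h\in\mathcal H$. Two standard normalized tight frames $\{x_j\}_j$ of $\mathcal H$ and $\{y_j\}_j$ of $\mathcal K$ are strongly disjoint if $\{x_j\oplus y_j\}_j$ is a standard normalized tight frame of $\mathcal H\oplus\mathcal K$. **Proposition.** (1) Let $\{x_j\}_j$ and $\{y_j\}_j$ be strongly disjoint standard normalized tight frames of $l_2(A)$. (a) If $T_1,T_2$ are adjointable bounded operators on $l_2(A)$ with $T_1T_1^*+T_2T_2^*=\mathrm{id}_{l_2(A)}$, then $\{T_1(x_j)+T_2(y_j)\}_j$ is a standard normalized tight frame of $l_2(A)$. (b) In particular, $\{\alpha x_j+\beta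 y_j\}_j$ is a standard normalized tight frame of $l_2(A)$ whenever $\alpha,\beta\in\mathbb C$ and $|\alpha|^2+|\beta|^2=1$. (c) Consequently $\{x_j\}_j$ and $\{y_j\}_j$ are connected by an arc within the set of standard normalized tight frames of $l_2(A)$. That is, there is a map $t\mapsto\{\gamma_j(t)\}_j$ from $[0,1]$ to this set with $\gamma_j(0)=x_j$ and $\gamma_j(1)=y_j$ for all $j$, injective if $\{x_j\}_j\neq\{y_j\}_j$, and continuous in the following sense: for all $s\in[0,1]$ and $\varepsilon>0$ there is $\delta>0$ such that for every $t\in[0,1]$ with $|t-s|<\delta$ and every $h\in l_2(A)$ the sum $\sum_j\langle h,\gamma_j(t)-\gamma_j(s)\rangle\langle\gamma_j(t)-\gamma_j(s),h\rangle$ converges in norm and is at most $\varepsilon^2\langle h,h\rangle$. (2) More generally, if $(\{x_{1j}\}_j,\dots,\{x_{nj}\}_j)$ is an $n$-tuple of pairwise strongly disjoint standard normalized tight frames of $l_2(A)$ and $(T_1,\dots,T_n)$ is an $n$-tuple of adjointable bounded operators on $l_2(A)$ with $\sum_{k=1}^nT_kT_k^*=\mathrm{id}_{l_2(A)}$, then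 $\{\sum_{k=1}^nT_k(x_{kj})\}_j$ is a standard normalized tight frame of $l_2(A)$. -/

import Mathlib

/-! Standard normalized tight frames in Hilbert C*-modules and the standard Hilbert module `l₂(A)`.

Modules over `A` are left modules. Mathlib's `inner A x y` is `A`-linear in the *second* variable,
so `inner A y x` is the inner product `⟨x, y⟩` that is `A`-linear in the first variable. -/

noncomputable section

namespace ModuleFrame

section HilbertModule

variable (A : Type*) [CStarAlgebra A] [PartialOrder A] [StarOrderedRing A]

lemma summable_of_nonneg_of_le {u v : ℕ → A} (hu : ∀ j, 0 ≤ u j) (huv : ∀ j, u j ≤ v j)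
    (hv : Summable v) : Summable u := by
  rw [summable_iff_vanishing_norm] at hv ⊢
  intro ε hε
  obtain ⟨s, hs⟩ := hv ε hε
  refine ⟨s, fun t ht => lt_of_le_of_lt ?_ (hs t ht)⟩
  exact CStarAlgebra.norm_le_norm_of_nonneg_of_le (Finset.sum_nonneg fun j _ => hu j)
    (Finset.sum_le_sum fun j _ => huv j)

/-- The sequences `a` in `A` for which `∑ⱼ aⱼ aⱼ*` converges in norm. (For a series of positive
elements convergence of the partial sums and unconditional convergence are the same.) -/
def l2Submodule : Submodule A (ℕ → A) where
  carrier := {a | Summable fun j => a j * star (a j)}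
  zero_mem' := by simp [summable_zero]
  add_mem' := by
    intro a b ha hb
    have hab := (ha.add hb).add (ha.add hb)
    refine summable_of_nonneg_of_le A (fun j => mul_star_self_nonneg _) (fun j => ?_) hab
    rw [← sub_nonneg]
    have h := mul_star_self_nonneg (a j - b j)
    convert h using 1
    simp only [Pi.add_apply, star_add, star_sub]
    noncomm_ring
  smul_mem' := by
    intro c a ha
    have h : Summable fun j => c * (a j * star (a j)) * star c :=
      (Summable.mul_left c ha).mul_right (star c)
    simpa [mul_assoc] using h

/-- The standard Hilbert `A`-module `l₂(A)`: the sequences `a` in `A` for which `∑ⱼ aⱼ aⱼ*`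
converges in norm. -/
def L2 : Type _ := l2Submodule A

variable {A}

instance : CoeFun (L2 A) fun _ => ℕ → A := ⟨Subtype.val⟩

instance : AddCommGroup (L2 A) := inferInstanceAs (AddCommGroup (l2Submodule A))
instance : Module A (L2 A) := inferInstanceAs (Module A (l2Submodule A))
instance : Module ℂ (L2 A) := inferInstanceAs (Module ℂ (l2Submodule A))

namespace L2

@[ext] lemma ext {a b : L2 A} (h : ∀ j, a j = b j) : a = b := Subtype.ext (funext h)
@[simp] lemma zero_apply (j : ℕ) : (0 : L2 A) j = 0 := rfl
@[simp] lemma add_apply (a b : L2 A) (j : ℕ) : (a + b) j = a j + b j := rfl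
@[simp] lemma smul_apply (c : A) (a : L2 A) (j : ℕ) : (c • a) j = c * a j := rfl
@[simp] lemma smul_complex_apply (c : ℂ) (a : L2 A) (j : ℕ) : (c • a) j = c • a j := rfl

lemma summable_mul_star_self (a : L2 A) : Summable fun j => a j * star (a j) := a.2

lemma summable_mul_star (a b : L2 A) : Summable fun j => b j * star (a j) := by
  have h1 := summable_mul_star_self (b + a)
  have h2 := summable_mul_star_self (b + (-1 : ℂ) • a)
  have h3 := summable_mul_star_self (b + Complex.I • a)
  have h4 := summable_mul_star_self (b + (-Complex.I) • a)
  have h := ((h1.sub h2).add ((h3.sub h4).const_smul Complex.I)).const_smul (1 / 4 : ℂ)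
  refine h.congr fun j => ?_
  simp only [add_apply, smul_complex_apply, star_add, star_smul, mul_add, add_mul, smul_mul_assoc,
    mul_smul_comm, smul_add, smul_sub, smul_smul]
  simp only [RCLike.star_def, map_neg, map_one, Complex.conj_I]
  (match_scalars <;> ring_nf <;> simp); norm_num

/-- The `A`-valued inner product `⟨b, a⟩ = ∑ⱼ bⱼ aⱼ*` (with `b` in the second slot); see the remark on conventions above. -/
def innerL2 (a b : L2 A) : A := ∑' j, b j * star (a j)

instance : Norm (L2 A) := ⟨fun a => √‖innerL2 a a‖⟩

instance : CStarModule A (L2 A) where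
  inner := innerL2
  inner_add_right {x y z} := by
    simp only [innerL2, add_apply, add_mul]
    exact (summable_mul_star x y).tsum_add (summable_mul_star x z)
  inner_self_nonneg {x} := tsum_nonneg fun j => mul_star_self_nonneg _
  inner_self {x} := by
    refine ⟨fun h => ?_, fun h => by simp [h, innerL2]⟩
    ext j
    rw [innerL2] at h
    have h1 : x j * star (x j) ≤ 0 := by
      rw [← h]
      exact (summable_mul_star_self x).le_tsum j fun i _ => mul_star_self_nonneg _
    exact (CStarRing.mul_star_self_eq_zero_iff _).mp (le_antisymm h1 (mul_star_self_nonneg _))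
  inner_op_smul_right {c x y} := by
    simp only [innerL2, smul_apply, mul_assoc]
    exact (summable_mul_star x y).tsum_mul_left c
  inner_smul_right_complex {z x y} := by
    simp only [innerL2, smul_complex_apply, smul_mul_assoc]
    exact (summable_mul_star x y).tsum_const_smul z
  star_inner x y := by
    simp only [innerL2]
    rw [tsum_star]
    simp
  norm_eq_sqrt_norm_inner_self x := rfl

lemma inner_def (a b : L2 A) : inner A a b = ∑' j, b j * star (a j) := rfl

instance : NormedAddCommGroup (L2 A) := NormedAddCommGroup.ofCore (CStarModule.normedSpaceCore A)
instance : NormedSpace ℂ (L2 A) := NormedSpace.ofCore (CStarModule.normedSpaceCore A)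

end L2

end HilbertModule

section Frames

variable (A : Type*) [CStarAlgebra A] [PartialOrder A] [StarOrderedRing A]
variable {E F J : Type*} [NormedAddCommGroup E] [NormedSpace ℂ E] [Module A E] [CStarModule A E]
variable [NormedAddCommGroup F] [NormedSpace ℂ F] [Module A F] [CStarModule A F]

/-- `x` is a standard normalized tight frame: `∑ⱼ ⟨h, xⱼ⟩ ⟨xⱼ, h⟩ = ⟨h, h⟩` for every `h`, with
convergence in norm. -/
def IsStdNormalizedTightFrame (x : J → E) : Prop :=
  ∀ h : E, HasSum (fun j => inner A (x j) h * inner A h (x j)) (inner A h h)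

/-- The inner sum `{xⱼ ⊕ yⱼ}` in the Hilbert module `E ⊕ F`. -/
def innerSum (x : J → E) (y : J → F) : J → WithCStarModule A (E × F) :=
  fun j => (WithCStarModule.equiv A (E × F)).symm (x j, y j)

/-- Strong disjointness of two standard normalized tight frames: their inner sum is a standard
normalized tight frame of the direct sum. -/
def StronglyDisjoint (x : J → E) (y : J → F) : Prop :=
  IsStdNormalizedTightFrame A (innerSum A x y)

/-- `S` is the adjoint `T*` of the operator `T`: `⟨T u, v⟩ = ⟨u, S v⟩`. -/
def IsAdjoint (T S : E →L[A] E) : Prop :=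
  ∀ u v : E, inner A v (T u) = inner A (S v) u

/-- The frame transforms `θ_u`, `θ_v` satisfy `‖θ_u - θ_v‖ ≤ ε`, that is,
`∑ⱼ ⟨h, uⱼ - vⱼ⟩ ⟨uⱼ - vⱼ, h⟩ ≤ ε² ⟨h, h⟩` for every `h`. This implies `‖uⱼ - vⱼ‖ ≤ ε` for
all `j`. -/
def FrameClose (ε : ℝ) (u v : J → E) : Prop :=
  ∀ h : E, ∃ s : A, HasSum (fun j => inner A (u j - v j) h * inner A h (u j - v j)) s ∧
    s ≤ (ε ^ 2) • inner A h h

/-- `x` and `y` are joined by an arc inside the set of standard normalized tight frames; the arc is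
continuous for the norm distance `‖θ_u - θ_v‖` of the frame transforms, and it does not meet
itself when its end points differ. -/
def ArcwiseConnected (x y : J → E) : Prop :=
  ∃ γ : ℝ → J → E, γ 0 = x ∧ γ 1 = y ∧
    (∀ t ∈ Set.Icc (0 : ℝ) 1, IsStdNormalizedTightFrame A (γ t)) ∧
    (∀ s ∈ Set.Icc (0 : ℝ) 1, ∀ ε > 0, ∃ δ > 0, ∀ t ∈ Set.Icc (0 : ℝ) 1, |t - s| < δ →
      FrameClose A ε (γ t) (γ s)) ∧
    (x ≠ y → Set.InjOn γ (Set.Icc 0 1))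

end Frames

end ModuleFrame

end

/-! Strong disjointness is the frame identity at `h ⊕ k` with `h` and `k` free. Moving the operators
across the inner product, the coefficient of `h` against `T₁ xⱼ + T₂ yⱼ` is that of `S₁ h ⊕ S₂ h`
against `xⱼ ⊕ yⱼ`. The frame sum is therefore `⟨S₁ h, S₁ h⟩ + ⟨S₂ h, S₂ h⟩ = ⟨h, (T₁ S₁ + T₂ S₂) h⟩
= ⟨h, h⟩`. Scalar combinations work alike for arbitrary `α, β`; applied to differences of points on
a quarter circle, this gives both continuity and injectivity of the arc. For `n` frames only pairs
are controlled, so the cross series must vanish one by one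
(`StronglyDisjoint.hasSum_inner_mul_inner`). -/

namespace ModuleFrame

section Combinations

variable {A : Type*} [CStarAlgebra A] [PartialOrder A] [StarOrderedRing A]
variable {E F J : Type*} [NormedAddCommGroup E] [NormedSpace ℂ E] [Module A E] [CStarModule A E]
variable [NormedAddCommGroup F] [NormedSpace ℂ F] [Module A F] [CStarModule A F]

/-- Strong disjointness, evaluated at the vector `h ⊕ k`. -/
lemma StronglyDisjoint.hasSum_add {x : J → E} {y : J → F} (hxy : StronglyDisjoint A x y)
    (h : E) (k : F) :
    HasSum (fun j => (inner A (x j) h + inner A (y j) k) * (inner A h (x j) + inner A k (y j)))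
      (inner A h h + inner A k k) := by
  simpa [innerSum, WithCStarModule.prod_inner] using
    hxy ((WithCStarModule.equiv A (E × F)).symm (h, k))

/-- The analysis sequences of strongly disjoint frames are orthogonal to each other. -/
lemma StronglyDisjoint.hasSum_inner_mul_inner {x : J → E} {y : J → F}
    (hx : IsStdNormalizedTightFrame A x) (hy : IsStdNormalizedTightFrame A y)
    (hxy : StronglyDisjoint A x y) (h : E) (k : F) :
    HasSum (fun j => inner A (x j) h * inner A k (y j)) 0 := by
  have cross (k : F) : HasSum
      (fun j => inner A (x j) h * inner A k (y j) + inner A (y j) k * inner A h (x j)) 0 := by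
    have := (hxy.hasSum_add h k).sub ((hx h).add (hy k))
    rw [sub_self] at this
    refine this.congr_fun fun j => ?_
    noncomm_ring
  -- Polarization: the first term is conjugate-linear in `k`, the second linear, so `k ↦ i k`
  -- followed by multiplication by `i` flips only the sign of the second.
  have := ((cross k).add ((cross (Complex.I • k)).const_smul Complex.I)).const_smul (1 / 2 : ℂ)
  simp only [smul_zero, add_zero] at this
  refine this.congr_fun fun j => ?_
  simp only [CStarModule.inner_smul_left_complex, CStarModule.inner_smul_right_complex,
    smul_mul_assoc, mul_smul_comm, smul_add, smul_smul, RCLike.star_def, Complex.conj_I]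
  (match_scalars <;> simp); norm_num

/-- The frame sum of a complex linear combination of strongly disjoint frames. -/
lemma StronglyDisjoint.hasSum_smul_add_smul {x y : J → E} (hxy : StronglyDisjoint A x y)
    (α β : ℂ) (h : E) :
    HasSum (fun j => inner A (α • x j + β • y j) h * inner A h (α • x j + β • y j))
      ((‖α‖ ^ 2 + ‖β‖ ^ 2) • inner A h h) := by
  convert hxy.hasSum_add (star α • h) (star β • h) using 1
  · ext j
    simp
  · simp only [CStarModule.inner_smul_left_complex, CStarModule.inner_smul_right_complex, smul_smul,
      star_star, ← add_smul]
    rw [← Complex.coe_smul]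
    congr 1
    simp [Complex.conj_mul']

lemma StronglyDisjoint.isStdNormalizedTightFrame_smul_add_smul {x y : J → E}
    (hxy : StronglyDisjoint A x y) {α β : ℂ} (hαβ : ‖α‖ ^ 2 + ‖β‖ ^ 2 = 1) :
    IsStdNormalizedTightFrame A (fun j => α • x j + β • y j) := fun h => by
  simpa [hαβ] using hxy.hasSum_smul_add_smul α β h

omit [StarOrderedRing A] in
lemma IsAdjoint.inner_apply_left {T S : E →L[A] E} (hTS : IsAdjoint A T S) (u v : E) :
    inner A (T u) v = inner A u (S v) := by
  rw [← CStarModule.star_inner, hTS, CStarModule.star_inner]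

lemma isStdNormalizedTightFrame_sum_apply {ι : Type*} [Fintype ι] {x : ι → J → E}
    {T S : ι → (E →L[A] E)} (hx : ∀ k, IsStdNormalizedTightFrame A (x k))
    (hdisj : ∀ k l, k ≠ l → StronglyDisjoint A (x k) (x l))
    (hadj : ∀ k, IsAdjoint A (T k) (S k))
    (hTS : ∑ k, T k ∘L S k = ContinuousLinearMap.id A E) :
    IsStdNormalizedTightFrame A (fun j => ∑ k, T k (x k j)) := by
  classical
  intro h
  -- Padding with off-diagonal zeros lets the `(k, l)` series be matched one at a time.
  have hh : inner A h h = ∑ k, ∑ l, if k = l then inner A (S k h) (S k h) else 0 := by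
    have hsum : ∑ k, T k (S k h) = h := by
      simpa using congr($hTS h)
    simp only [Finset.sum_ite_eq, Finset.mem_univ, if_true, ← (hadj _) _ h]
    rw [← CStarModule.inner_sum_right, hsum]
  rw [hh]
  simp only [CStarModule.inner_sum_left, CStarModule.inner_sum_right, (hadj _).inner_apply_left,
    hadj _ _ h, Finset.sum_mul_sum]
  refine hasSum_sum fun k _ => hasSum_sum fun l _ => ?_
  split_ifs with hkl
  · subst hkl
    exact hx k (S k h)
  · exact (hdisj k l hkl).hasSum_inner_mul_inner (hx k) (hx l) (S k h) (S l h)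

lemma StronglyDisjoint.isStdNormalizedTightFrame_apply_add_apply {x y : J → E}
    (hxy : StronglyDisjoint A x y) {T₁ S₁ T₂ S₂ : E →L[A] E}
    (h₁ : IsAdjoint A T₁ S₁) (h₂ : IsAdjoint A T₂ S₂)
    (hTS : T₁ ∘L S₁ + T₂ ∘L S₂ = ContinuousLinearMap.id A E) :
    IsStdNormalizedTightFrame A (fun j => T₁ (x j) + T₂ (y j)) := fun h => by
  convert hxy.hasSum_add (S₁ h) (S₂ h) using 1
  · ext j
    simp [h₁.inner_apply_left, h₂.inner_apply_left, h₁ _ h, h₂ _ h]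
  · rw [← h₁, ← h₂, ← CStarModule.inner_add_right]
    exact congrArg (inner A h) (congr($hTS h)).symm

/-- The arc is `t ↦ cos (π t / 2) x + sin (π t / 2) y`. -/
lemma StronglyDisjoint.arcwiseConnected {x y : J → E} (hxy : StronglyDisjoint A x y) :
    ArcwiseConnected A x y := by
  set c : ℝ → ℝ := fun t => Real.cos (Real.pi / 2 * t) with hc
  set s : ℝ → ℝ := fun t => Real.sin (Real.pi / 2 * t) with hs
  have hdiff (t u : ℝ) (j : J) :
      ((c t : ℂ) • x j + (s t : ℂ) • y j) - ((c u : ℂ) • x j + (s u : ℂ) • y j) =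
        ((c t - c u : ℝ) : ℂ) • x j + ((s t - s u : ℝ) : ℂ) • y j := by
    push_cast
    module
  refine ⟨fun t j => (c t : ℂ) • x j + (s t : ℂ) • y j, ?_, ?_, fun t _ => ?_, ?_, ?_⟩
  · ext j
    simp [hc, hs]
  · ext j
    simp [hc, hs]
  · refine hxy.isStdNormalizedTightFrame_smul_add_smul ?_
    simp [hc, hs, -Complex.ofReal_cos, -Complex.ofReal_sin]
  · intro u _ ε hε
    have hcont : ContinuousAt (fun t => (c t - c u) ^ 2 + (s t - s u) ^ 2) u := by
      fun_prop
    obtain ⟨δ, hδ, H⟩ := Metric.continuousAt_iff.1 hcont (ε ^ 2) (by positivity)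
    -- The frame sum of the difference is exactly a scalar multiple of `⟨h, h⟩`, so one `δ` serves
    -- every `h`.
    refine ⟨δ, hδ, fun t _ ht h =>
      ⟨_, (hxy.hasSum_smul_add_smul (c t - c u : ℝ) (s t - s u : ℝ) h).congr_fun
        fun j => by simp only [hdiff], ?_⟩⟩
    · refine smul_le_smul_of_nonneg_right ?_ CStarModule.inner_self_nonneg
      have := H (x := t) (by rwa [Real.dist_eq])
      simp only [sub_self, Real.dist_eq] at this
      simp only [Complex.norm_real, Real.norm_eq_abs, sq_abs]
      have := (abs_lt.1 this).2
      linarith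
  · intro hne t ht u hu htu
    by_contra htu'
    have hcne : c t ≠ c u := fun h => by
      have hmem {v : ℝ} (hv : v ∈ Set.Icc (0 : ℝ) 1) : Real.pi / 2 * v ∈ Set.Icc 0 Real.pi :=
        ⟨by have := hv.1; positivity, by nlinarith [hv.2, Real.pi_pos]⟩
      have := Real.injOn_cos (hmem ht) (hmem hu) h
      exact htu' (mul_left_cancel₀ (by positivity) this)
    refine hne (funext fun j => ?_)
    -- If two points of the arc coincide, their difference is the zero family, yet its frame sum is
    -- a positive multiple of `⟨h, h⟩`. The module is then trivial, forcing `x = y`.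
    have hzero (h : E) : h = 0 := by
      have hsum := hxy.hasSum_smul_add_smul (c t - c u : ℝ) (s t - s u : ℝ) h
      have hj (j : J) : ((c t - c u : ℝ) : ℂ) • x j + ((s t - s u : ℝ) : ℂ) • y j = 0 := by
        rw [← hdiff]
        exact sub_eq_zero.2 (congrFun htu j)
      simp only [hj, CStarModule.inner_zero_left, zero_mul] at hsum
      have h0 := hsum.unique hasSum_zero
      rw [smul_eq_zero] at h0
      refine CStarModule.inner_self.1 (h0.resolve_left ?_)
      have : 0 < ‖((c t - c u : ℝ) : ℂ)‖ := by
        rw [norm_pos_iff, Complex.ofReal_ne_zero]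
        exact sub_ne_zero.2 hcne
      positivity
    rw [hzero (x j), hzero (y j)]

end Combinations

end ModuleFrame

theorem mainTheorem9 {A : Type*} [CStarAlgebra A] [PartialOrder A] [StarOrderedRing A]
    {J : Type*} [Countable J] :
    (∀ x y : J → ModuleFrame.L2 A,
      ModuleFrame.IsStdNormalizedTightFrame A x →
      ModuleFrame.IsStdNormalizedTightFrame A y →
      ModuleFrame.StronglyDisjoint A x y →
        (∀ T₁ S₁ T₂ S₂ : ModuleFrame.L2 A →L[A] ModuleFrame.L2 A,
          ModuleFrame.IsAdjoint A T₁ S₁ → ModuleFrame.IsAdjoint A T₂ S₂ →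
          T₁ ∘L S₁ + T₂ ∘L S₂ = ContinuousLinearMap.id A (ModuleFrame.L2 A) →
          ModuleFrame.IsStdNormalizedTightFrame A (fun j => T₁ (x j) + T₂ (y j))) ∧
        (∀ α β : ℂ, ‖α‖ ^ 2 + ‖β‖ ^ 2 = 1 →
          ModuleFrame.IsStdNormalizedTightFrame A (fun j => α • x j + β • y j)) ∧
        ModuleFrame.ArcwiseConnected A x y) ∧
    (∀ (n : ℕ) (x : Fin n → J → ModuleFrame.L2 A)
      (T S : Fin n → (ModuleFrame.L2 A →L[A] ModuleFrame.L2 A)),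
      (∀ k, ModuleFrame.IsStdNormalizedTightFrame A (x k)) →
      (∀ k l, k ≠ l → ModuleFrame.StronglyDisjoint A (x k) (x l)) →
      (∀ k, ModuleFrame.IsAdjoint A (T k) (S k)) →
      ∑ k, T k ∘L S k = ContinuousLinearMap.id A (ModuleFrame.L2 A) →
      ModuleFrame.IsStdNormalizedTightFrame A (fun j => ∑ k, T k (x k j))) :=
  ⟨fun _ _ _ _ hxy =>
    ⟨fun _ _ _ _ h₁ h₂ hTS => hxy.isStdNormalizedTightFrame_apply_add_apply h₁ h₂ hTS,
      fun _ _ hαβ => hxy.isStdNormalizedTightFrame_smul_add_smul hαβ, hxy.arcwiseConnected⟩,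
    fun _ _ _ _ hx hdisj hadj hTS =>
      ModuleFrame.isStdNormalizedTightFrame_sum_apply hx hdisj hadj hTS⟩
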